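/- Let $K\ge 2$ and $d\ge 1$ be integers and let $S_1,\dots,S_K$ be real $d\times d$ matrices. For a switching law $\sigma\colon\{1,2,\dots\}\to\{1,\dots,K\}$ and $x_0\in\mathbb{R}^d$ write $x_n(x_0,\sigma)=S_{\sigma(n)}\cdots S_{\sigma(1)}x_0$. Let $\|\cdot\|$ be the Euclidean norm on $\mathbb{R}^d$, and for a $d\times d$ matrix $A$ put $\|A\|=\max_{\|x\|=1}\|Ax\|$ and $\|A\|_{\mathrm{co}}=\min_{\|x\|=1}\|Ax\|$. A switching law $\sigma$ is called fiber-chaotic if, for every $x_0\in\mathbb{R}^d\setminus\{0\}$, $$\liminf_{n\to\infty}\|x_n(x_0,\sigma)\|=0\quad\text{and}\quad\limsup_{n\to\infty}\|x_n(x_0,\sigma)\|=\infty .$$ The joint spectral radius of the system is $$\widehat\rho=\lim_{n\to\infty}\max_{\sigma}\|S_{\sigma(n)}\cdots S_{\sigma(1)}\|^{1/n},$$ and, when $S_1,\dots,S_K$ are all nonsingular, the joint spectral co-radius is $$\widehat\rho_{\mathrm{co}}=\lim_{n\to\infty}\min_{\sigma}\|S_{\sigma(n)}\cdots S_{\sigma(1)}\|_{\mathrm{co}}^{1/n}.$$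 Theorem 5.1. (1) If $\widehat\rho=1$, then there is no fiber-chaotic switching law. (2) If $S_1,\dots,S_K$ are all nonsingular and $\widehat\rho_{\mathrm{co}}=1$, then there is no fiber-chaotic switching law. -/

import Mathlib

open Filter Topology

namespace LinearInclusion

/-- The state space `ℝ^d` with its Euclidean norm. -/
abbrev State (d : ℕ) := EuclideanSpace ℝ (Fin d)

/-- A real `d × d` matrix as a (continuous) linear map of Euclidean space. -/
noncomputable abbrev toMap {d : ℕ} (A : Matrix (Fin d) (Fin d) ℝ) : State d →L[ℝ] State d :=
  Matrix.toEuclideanCLM (n := Fin d) (𝕜 := ℝ) A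

/-- The matrix norm `‖A‖ = max_{‖x‖ = 1} ‖A x‖`, i.e. the operator norm for the Euclidean norm. -/
noncomputable def matNorm {d : ℕ} (A : Matrix (Fin d) (Fin d) ℝ) : ℝ := ‖toMap A‖

/-- The co-norm `‖A‖_co = min_{‖x‖ = 1} ‖A x‖`. -/
noncomputable def matCoNorm {d : ℕ} (A : Matrix (Fin d) (Fin d) ℝ) : ℝ :=
  sInf ((fun x : State d => ‖toMap A x‖) '' Metric.sphere 0 1)

/-- The product `S_{σ(n)} ⋯ S_{σ(1)}`. Switching laws `σ : ℕ → Fin K` are indexed from `0`,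
so that the `n`-th symbol of the law is `σ (n - 1)`; the empty product is the identity. -/
def switchProd {d K : ℕ} (S : Fin K → Matrix (Fin d) (Fin d) ℝ) (σ : ℕ → Fin K) :
    ℕ → Matrix (Fin d) (Fin d) ℝ
  | 0 => 1
  | n + 1 => S (σ n) * switchProd S σ n

/-- The state trajectory: `x_0 = x` and `x_{n+1}` is obtained from `x_n` by applying
the matrix that the switching law selects. -/
noncomputable def trajectory {d K : ℕ} (S : Fin K → Matrix (Fin d) (Fin d) ℝ) (σ : ℕ → Fin K)
    (x : State d) : ℕ → State d
  | 0 => x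
  | n + 1 => toMap (S (σ n)) (trajectory S σ x n)

/-- `σ` is fiber-chaotic if for every nonzero initial state
`liminf ‖x_n‖ = 0` and `limsup ‖x_n‖ = ∞` (taken in `[0, ∞]`). -/
def IsFiberChaotic {d K : ℕ} (S : Fin K → Matrix (Fin d) (Fin d) ℝ) (σ : ℕ → Fin K) : Prop :=
  ∀ x : State d, x ≠ 0 →
    liminf (fun n => ‖trajectory S σ x n‖ₑ) atTop = 0 ∧
    limsup (fun n => ‖trajectory S σ x n‖ₑ) atTop = ⊤

/-- `max_σ ‖S_{σ(n)} ⋯ S_{σ(1)}‖^{1/n}`; only finitely many products occur for a given `n`,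
so the supremum is a maximum. -/
noncomputable def maxRoot {d K : ℕ} (S : Fin K → Matrix (Fin d) (Fin d) ℝ) (n : ℕ) : ℝ :=
  ⨆ σ : ℕ → Fin K, matNorm (switchProd S σ n) ^ (1 / (n : ℝ))

/-- `min_σ ‖S_{σ(n)} ⋯ S_{σ(1)}‖_co^{1/n}`; again the infimum is a minimum. -/
noncomputable def minCoRoot {d K : ℕ} (S : Fin K → Matrix (Fin d) (Fin d) ℝ) (n : ℕ) : ℝ :=
  ⨅ σ : ℕ → Fin K, matCoNorm (switchProd S σ n) ^ (1 / (n : ℝ))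

/-- The joint spectral radius `lim_n max_σ ‖S_{σ(n)} ⋯ S_{σ(1)}‖^{1/n}`.
The limit exists, see `tendsto_jointSpectralRadius`. -/
noncomputable def jointSpectralRadius {d K : ℕ} (S : Fin K → Matrix (Fin d) (Fin d) ℝ) : ℝ :=
  limUnder atTop (maxRoot S)

/-- The joint spectral co-radius `lim_n min_σ ‖S_{σ(n)} ⋯ S_{σ(1)}‖_co^{1/n}`.
For nonsingular matrices the limit exists, see `tendsto_jointSpectralCoRadius`. -/
noncomputable def jointSpectralCoRadius {d K : ℕ} (S : Fin K → Matrix (Fin d) (Fin d) ℝ) : ℝ :=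
  limUnder atTop (minCoRoot S)

/-! Existence of the two limits, so that the definitions above are not junk values. -/

theorem switchProd_congr {d K : ℕ} (S : Fin K → Matrix (Fin d) (Fin d) ℝ) (σ τ : ℕ → Fin K)
    (n : ℕ) (h : ∀ i < n, σ i = τ i) : switchProd S σ n = switchProd S τ n := by
  induction n with
  | zero => rfl
  | succ n ih =>
    simp only [switchProd]
    rw [h n (Nat.lt_succ_self n), ih fun i hi => h i (Nat.lt_succ_of_lt hi)]

theorem finite_range_switchProd {d K : ℕ} (S : Fin K → Matrix (Fin d) (Fin d) ℝ) (n : ℕ) :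
    (Set.range fun σ : ℕ → Fin K => switchProd S σ n).Finite := by
  classical
  rcases Nat.eq_zero_or_pos K with rfl | hK
  · have : IsEmpty (ℕ → Fin 0) := ⟨fun f => (f 0).elim0⟩
    rw [Set.range_eq_empty]
    exact Set.finite_empty
  · refine (Set.finite_range fun w : Fin n → Fin K =>
      switchProd S (fun i => if h : i < n then w ⟨i, h⟩ else ⟨0, hK⟩) n).subset ?_
    rintro _ ⟨σ, rfl⟩
    refine ⟨fun i => σ i, ?_⟩
    apply switchProd_congr
    intro i hi
    simp [hi]

theorem finite_range_comp {d K : ℕ} (S : Fin K → Matrix (Fin d) (Fin d) ℝ) (n : ℕ)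
    (f : Matrix (Fin d) (Fin d) ℝ → ℝ) :
    (Set.range fun σ : ℕ → Fin K => f (switchProd S σ n)).Finite := by
  have := (finite_range_switchProd S n).image f
  rwa [← Set.range_comp] at this

theorem switchProd_add {d K : ℕ} (S : Fin K → Matrix (Fin d) (Fin d) ℝ) (σ : ℕ → Fin K)
    (m n : ℕ) :
    switchProd S σ (m + n) = switchProd S (fun i => σ (m + i)) n * switchProd S σ m := by
  induction n with
  | zero => simp [switchProd]
  | succ n ih => rw [← add_assoc]; simp only [switchProd]; rw [ih, mul_assoc]

theorem trajectory_eq {d K : ℕ} (S : Fin K → Matrix (Fin d) (Fin d) ℝ) (σ : ℕ → Fin K)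
    (x : State d) (n : ℕ) : trajectory S σ x n = toMap (switchProd S σ n) x := by
  induction n with
  | zero => simp [trajectory, switchProd, toMap]
  | succ n ih => simp [trajectory, switchProd, toMap, ih]

theorem matNorm_mul_le {d : ℕ} (A B : Matrix (Fin d) (Fin d) ℝ) :
    matNorm (A * B) ≤ matNorm A * matNorm B := by
  simp only [matNorm, toMap, map_mul]
  exact norm_mul_le _ _

theorem matCoNorm_nonneg {d : ℕ} (A : Matrix (Fin d) (Fin d) ℝ) : 0 ≤ matCoNorm A := by
  apply Real.sInf_nonneg
  rintro _ ⟨x, -, rfl⟩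
  exact norm_nonneg _

theorem matCoNorm_mul_norm_le {d : ℕ} (A : Matrix (Fin d) (Fin d) ℝ) (x : State d) :
    matCoNorm A * ‖x‖ ≤ ‖toMap A x‖ := by
  rcases eq_or_ne x 0 with rfl | hx
  · simp
  have hx' : 0 < ‖x‖ := norm_pos_iff.2 hx
  have h : matCoNorm A ≤ ‖toMap A (‖x‖⁻¹ • x)‖ := by
    refine csInf_le ⟨0, ?_⟩ ⟨‖x‖⁻¹ • x, ?_, rfl⟩
    · rintro _ ⟨y, -, rfl⟩
      exact norm_nonneg _
    · simp [norm_smul, hx'.ne']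
  rw [map_smul, norm_smul, norm_inv, norm_norm] at h
  calc matCoNorm A * ‖x‖ ≤ (‖x‖⁻¹ * ‖toMap A x‖) * ‖x‖ := by gcongr
    _ = ‖toMap A x‖ := by field_simp

theorem sphere_nonempty {d : ℕ} (hd : 1 ≤ d) : (Metric.sphere (0 : State d) 1).Nonempty :=
  ⟨EuclideanSpace.single ⟨0, hd⟩ 1, by simp⟩

theorem le_matCoNorm_mul {d : ℕ} (hd : 1 ≤ d) (A B : Matrix (Fin d) (Fin d) ℝ) :
    matCoNorm A * matCoNorm B ≤ matCoNorm (A * B) := by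
  apply le_csInf ((sphere_nonempty hd).image _)
  rintro _ ⟨x, hx, rfl⟩
  have hx1 : ‖x‖ = 1 := by simpa using hx
  have h1 := matCoNorm_mul_norm_le B x
  have h2 := matCoNorm_mul_norm_le A (toMap B x)
  rw [hx1, mul_one] at h1
  have h3 : toMap (A * B) x = toMap A (toMap B x) := by simp [toMap]
  simp only [h3]
  exact (mul_le_mul_of_nonneg_left h1 (matCoNorm_nonneg A)).trans h2

theorem matCoNorm_pos {d : ℕ} (hd : 1 ≤ d) (A : Matrix (Fin d) (Fin d) ℝ) (hA : IsUnit A) :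
    0 < matCoNorm A := by
  obtain ⟨x, hx, hmin⟩ := (isCompact_sphere (0 : State d) 1).exists_sInf_image_eq
    (sphere_nonempty hd) (f := fun x : State d => ‖toMap A x‖) (by fun_prop)
  rw [matCoNorm, hmin]
  apply norm_pos_iff.2
  intro h0
  obtain ⟨B, hB⟩ := hA.exists_left_inv
  have h1 : toMap (B * A) x = toMap B (toMap A x) := by simp [toMap]
  rw [hB, h0] at h1
  have h2 : x = 0 := by simpa [toMap] using h1
  simp [h2] at hx

theorem matCoNorm_le {d : ℕ} (hd : 1 ≤ d) (A : Matrix (Fin d) (Fin d) ℝ) :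
    matCoNorm A ≤ matNorm A := by
  obtain ⟨x, hx⟩ := sphere_nonempty hd
  have hx1 : ‖x‖ = 1 := by simpa using hx
  have h1 := matCoNorm_mul_norm_le A x
  have h2 := (toMap A).le_opNorm x
  rw [hx1, mul_one] at h1 h2
  exact h1.trans h2

theorem isUnit_switchProd {d K : ℕ} (S : Fin K → Matrix (Fin d) (Fin d) ℝ)
    (hS : ∀ k, IsUnit (S k)) (σ : ℕ → Fin K) (n : ℕ) : IsUnit (switchProd S σ n) := by
  induction n with
  | zero => exact isUnit_one
  | succ n ih => exact (hS _).mul ih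

/-- Multiplicative form of Fekete's lemma for nonnegative sequences. -/
theorem exists_tendsto_root_of_submul (M : ℕ → ℝ) (h0 : ∀ n, 0 ≤ M n)
    (hM : ∀ m n, M (m + n) ≤ M m * M n) :
    ∃ L, Tendsto (fun n : ℕ => M n ^ (1 / (n : ℝ))) atTop (𝓝 L) := by
  have key : ∀ c : ℝ, 0 < c →
      ∃ L, Tendsto (fun n : ℕ => max (M n ^ (1 / (n : ℝ))) c) atTop (𝓝 L) := by
    intro c hc
    have hpos : ∀ n : ℕ, 0 < max (M n) (c ^ n) := fun n => lt_max_of_lt_right (pow_pos hc n)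
    have hsub : Subadditive fun n : ℕ => Real.log (max (M n) (c ^ n)) := by
      intro m n
      rw [← Real.log_mul (hpos m).ne' (hpos n).ne']
      apply Real.log_le_log (hpos _)
      apply max_le
      · exact (hM m n).trans (mul_le_mul (le_max_left _ _) (le_max_left _ _) (h0 n) (hpos m).le)
      · rw [pow_add]
        exact mul_le_mul (le_max_right _ _) (le_max_right _ _) (pow_pos hc n).le (hpos m).le
    have hbdd : BddBelow (Set.range fun n : ℕ => Real.log (max (M n) (c ^ n)) / n) := by
      refine ⟨min 0 (Real.log c), ?_⟩
      rintro _ ⟨n, rfl⟩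
      rcases Nat.eq_zero_or_pos n with rfl | hn
      · simp
      · refine (min_le_right _ _).trans ?_
        have hn' : (0 : ℝ) < n := by exact_mod_cast hn
        show Real.log c ≤ Real.log (max (M n) (c ^ n)) / n
        rw [le_div_iff₀ hn', mul_comm, ← Real.log_pow]
        exact Real.log_le_log (pow_pos hc n) (le_max_right _ _)
    refine ⟨Real.exp hsub.lim, ?_⟩
    refine ((Real.continuous_exp.tendsto _).comp (hsub.tendsto_lim hbdd)).congr' ?_
    filter_upwards [eventually_ge_atTop 1] with n hn
    have hn' : (0 : ℝ) < n := by exact_mod_cast hn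
    have hroot : (c ^ n) ^ (1 / (n : ℝ)) = c := by
      rw [one_div]
      exact Real.pow_rpow_inv_natCast hc.le (by omega)
    have h1 : Real.exp (Real.log (max (M n) (c ^ n)) / n) = max (M n) (c ^ n) ^ (1 / (n : ℝ)) := by
      rw [Real.rpow_def_of_pos (hpos n)]
      congr 1
      ring
    show Real.exp (Real.log (max (M n) (c ^ n)) / n) = _
    rw [h1]
    rcases le_total (M n) (c ^ n) with h | h
    · rw [max_eq_right h, hroot, max_eq_right]
      calc M n ^ (1 / (n : ℝ)) ≤ (c ^ n) ^ (1 / (n : ℝ)) :=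
            Real.rpow_le_rpow (h0 n) h (by positivity)
        _ = c := hroot
    · rw [max_eq_left h, max_eq_left]
      calc c = (c ^ n) ^ (1 / (n : ℝ)) := hroot.symm
        _ ≤ M n ^ (1 / (n : ℝ)) := Real.rpow_le_rpow (by positivity) h (by positivity)
  by_cases hex : ∃ c : ℝ, 0 < c ∧
      ∃ L, c < L ∧ Tendsto (fun n : ℕ => max (M n ^ (1 / (n : ℝ))) c) atTop (𝓝 L)
  · obtain ⟨c, -, L, hcL, hL⟩ := hex
    refine ⟨L, hL.congr' ?_⟩
    filter_upwards [hL.eventually_const_lt hcL] with n hn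
    rcases lt_max_iff.1 hn with h | h
    · exact max_eq_left h.le
    · exact absurd h (lt_irrefl c)
  · push Not at hex
    refine ⟨0, ?_⟩
    rw [tendsto_order]
    constructor
    · intro a ha
      exact Eventually.of_forall fun n => ha.trans_le (Real.rpow_nonneg (h0 n) _)
    · intro a ha
      obtain ⟨L, hL⟩ := key (a / 2) (by positivity)
      have hLa : L < a := by
        by_contra hcon
        exact hex (a / 2) (by positivity) L (by linarith) hL
      filter_upwards [hL.eventually_lt_const hLa] with n hn
      exact (le_max_left _ _).trans_lt hn

theorem maxRoot_eq {d K : ℕ} (hK : 1 ≤ K) (S : Fin K → Matrix (Fin d) (Fin d) ℝ) (n : ℕ) :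
    maxRoot S n = (⨆ σ : ℕ → Fin K, matNorm (switchProd S σ n)) ^ (1 / (n : ℝ)) := by
  have : Nonempty (ℕ → Fin K) := ⟨fun _ => ⟨0, hK⟩⟩
  obtain ⟨τ, hτ⟩ := (Set.range_nonempty _).csSup_mem (finite_range_comp S n matNorm)
  apply le_antisymm
  · refine ciSup_le fun σ => ?_
    exact Real.rpow_le_rpow (norm_nonneg _)
      (le_ciSup (finite_range_comp S n matNorm).bddAbove σ) (by positivity)
  · rw [iSup, ← hτ]
    exact le_ciSup (finite_range_comp S n fun A => matNorm A ^ (1 / (n : ℝ))).bddAbove τ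

theorem minCoRoot_eq {d K : ℕ} (hK : 1 ≤ K) (S : Fin K → Matrix (Fin d) (Fin d) ℝ) (n : ℕ) :
    minCoRoot S n = (⨅ σ : ℕ → Fin K, matCoNorm (switchProd S σ n)) ^ (1 / (n : ℝ)) := by
  have : Nonempty (ℕ → Fin K) := ⟨fun _ => ⟨0, hK⟩⟩
  obtain ⟨τ, hτ⟩ := (Set.range_nonempty _).csInf_mem (finite_range_comp S n matCoNorm)
  apply le_antisymm
  · rw [iInf, ← hτ]
    exact ciInf_le (finite_range_comp S n fun A => matCoNorm A ^ (1 / (n : ℝ))).bddBelow τ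
  · refine le_ciInf fun σ => ?_
    exact Real.rpow_le_rpow (Real.iInf_nonneg fun _ => matCoNorm_nonneg _)
      (ciInf_le (finite_range_comp S n matCoNorm).bddBelow σ) (by positivity)

theorem tendsto_jointSpectralRadius {d K : ℕ} (hK : 1 ≤ K)
    (S : Fin K → Matrix (Fin d) (Fin d) ℝ) :
    Tendsto (maxRoot S) atTop (𝓝 (jointSpectralRadius S)) := by
  have : Nonempty (ℕ → Fin K) := ⟨fun _ => ⟨0, hK⟩⟩
  apply tendsto_nhds_limUnder
  rw [funext (maxRoot_eq hK S)]
  have hn : ∀ n, 0 ≤ ⨆ σ : ℕ → Fin K, matNorm (switchProd S σ n) :=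
    fun n => Real.iSup_nonneg fun _ => norm_nonneg _
  refine exists_tendsto_root_of_submul _ hn fun m n => ciSup_le fun σ => ?_
  rw [switchProd_add, mul_comm (⨆ _, _)]
  refine (matNorm_mul_le _ _).trans (mul_le_mul ?_ ?_ (norm_nonneg _) (hn n))
  · exact le_ciSup (finite_range_comp S n matNorm).bddAbove fun i => σ (m + i)
  · exact le_ciSup (finite_range_comp S m matNorm).bddAbove σ

theorem tendsto_jointSpectralCoRadius {d K : ℕ} (hK : 1 ≤ K) (hd : 1 ≤ d)
    (S : Fin K → Matrix (Fin d) (Fin d) ℝ) (hS : ∀ k, IsUnit (S k)) :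
    Tendsto (minCoRoot S) atTop (𝓝 (jointSpectralCoRadius S)) := by
  have : Nonempty (ℕ → Fin K) := ⟨fun _ => ⟨0, hK⟩⟩
  apply tendsto_nhds_limUnder
  rw [funext (minCoRoot_eq hK S)]
  set N : ℕ → ℝ := fun n => ⨅ σ : ℕ → Fin K, matCoNorm (switchProd S σ n) with hN
  have hle : ∀ n σ, N n ≤ matCoNorm (switchProd S σ n) := fun n σ =>
    ciInf_le (finite_range_comp S n matCoNorm).bddBelow σ
  have hpos : ∀ n, 0 < N n := by
    intro n
    obtain ⟨τ, hτ⟩ := (Set.range_nonempty _).csInf_mem (finite_range_comp S n matCoNorm)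
    rw [hN]
    simp only
    rw [iInf, ← hτ]
    exact matCoNorm_pos hd _ (isUnit_switchProd S hS τ n)
  have hsup : ∀ m n, N m * N n ≤ N (m + n) := by
    intro m n
    refine le_ciInf fun σ => ?_
    rw [switchProd_add, mul_comm]
    exact (mul_le_mul (hle n _) (hle m σ) (hpos m).le (matCoNorm_nonneg _)).trans
      (le_matCoNorm_mul hd _ _)
  obtain ⟨L, hL⟩ := exists_tendsto_root_of_submul (fun n => (N n)⁻¹)
    (fun n => (inv_pos.2 (hpos n)).le) (fun m n => by
      rw [← mul_inv]
      exact inv_anti₀ (mul_pos (hpos m) (hpos n)) (hsup m n))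
  -- the inverses stay away from zero because the products grow at most exponentially
  obtain ⟨c, hc, hcN⟩ : ∃ c : ℝ, 0 < c ∧ ∀ n, N n ≤ c ^ n := by
    refine ⟨matNorm (S ⟨0, hK⟩) + 1, add_pos_of_nonneg_of_pos (norm_nonneg _) one_pos,
      fun n => (hle n fun _ => ⟨0, hK⟩).trans ((matCoNorm_le hd _).trans ?_)⟩
    induction n with
    | zero =>
      simp only [switchProd, matNorm, toMap, map_one, pow_zero]
      exact ContinuousLinearMap.norm_id_le
    | succ n ih =>
      rw [pow_succ']
      exact (matNorm_mul_le _ _).trans (mul_le_mul (by linarith) ih (norm_nonneg _)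
        (add_nonneg (norm_nonneg _) zero_le_one))
  have hLpos : c⁻¹ ≤ L := by
    refine ge_of_tendsto hL ?_
    filter_upwards [eventually_ge_atTop 1] with n hn
    calc c⁻¹ = ((c⁻¹) ^ n) ^ (1 / (n : ℝ)) := by
          rw [one_div]
          exact (Real.pow_rpow_inv_natCast (inv_pos.2 hc).le (by omega)).symm
      _ ≤ (N n)⁻¹ ^ (1 / (n : ℝ)) := by
          refine Real.rpow_le_rpow (by positivity) ?_ (by positivity)
          rw [inv_pow]
          exact inv_anti₀ (hpos n) (hcN n)
  have hL0 : L ≠ 0 := ((inv_pos.2 hc).trans_le hLpos).ne'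
  refine ⟨L⁻¹, (hL.inv₀ hL0).congr fun n => ?_⟩
  rw [Real.inv_rpow (hpos n).le, inv_inv]

end LinearInclusion

namespace LinearInclusion

/-! A fiber-chaotic `σ` doubles every nonzero vector at some time and halves it at some time. By
compactness of the unit sphere and homogeneity, these times are bounded by one `N` for all vectors
(`exists_bound_growth`, `exists_bound_decay`). The law may be restarted: once the vector has
doubled, run `σ` from its first symbol on the state reached, and repeat. After `k` rounds, at a time
`m` with `k ≤ m ≤ k * N`, the norm has grown at least by `2 ^ k`, so some product of length `m` has
norm root at least `2 ^ (1 / N)`. Such `m` are arbitrarily large, hence the joint spectral radius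
exceeds `1`. Halving instead gives a co-radius at most the inverse of `2 ^ (1 / N)`, hence below
`1`. -/

theorem exists_two_lt_norm_trajectory {d K : ℕ} {S : Fin K → Matrix (Fin d) (Fin d) ℝ}
    {σ : ℕ → Fin K} {x : State d}
    (h : limsup (fun n => ‖trajectory S σ x n‖ₑ) atTop = ⊤) :
    ∃ n, 2 < ‖trajectory S σ x n‖ := by
  by_contra! hcon
  have hle : limsup (fun n => ‖trajectory S σ x n‖ₑ) atTop ≤ ENNReal.ofReal 2 := by
    refine limsup_le_of_le (h := Eventually.of_forall fun n => ?_)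
    rw [← ofReal_norm]
    exact ENNReal.ofReal_le_ofReal (hcon n)
  rw [h] at hle
  exact absurd hle (by simp)

theorem exists_two_mul_norm_trajectory_lt {d K : ℕ} {S : Fin K → Matrix (Fin d) (Fin d) ℝ}
    {σ : ℕ → Fin K} {x : State d}
    (h : liminf (fun n => ‖trajectory S σ x n‖ₑ) atTop = 0) :
    ∃ n, 2 * ‖trajectory S σ x n‖ < 1 := by
  by_contra! hcon
  have hle : ENNReal.ofReal (1 / 2) ≤ liminf (fun n => ‖trajectory S σ x n‖ₑ) atTop := by
    refine le_liminf_of_le (h := Eventually.of_forall fun n => ?_)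
    rw [← ofReal_norm]
    exact ENNReal.ofReal_le_ofReal (by linarith [hcon n])
  rw [h] at hle
  exact absurd hle (by simp)

theorem trajectory_smul {d K : ℕ} (S : Fin K → Matrix (Fin d) (Fin d) ℝ) (σ : ℕ → Fin K)
    (c : ℝ) (x : State d) (n : ℕ) : trajectory S σ (c • x) n = c • trajectory S σ x n := by
  simp only [trajectory_eq, map_smul]

theorem continuous_trajectory {d K : ℕ} (S : Fin K → Matrix (Fin d) (Fin d) ℝ) (σ : ℕ → Fin K)
    (n : ℕ) : Continuous fun x => trajectory S σ x n := by
  simp only [trajectory_eq]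
  fun_prop

/-- A countable open cover of a compact set has a finite initial piece that covers. -/
theorem exists_bound_of_isCompact {X : Type*} [TopologicalSpace X] {s : Set X}
    (hs : IsCompact s) {U : ℕ → Set X} (hU : ∀ n, IsOpen (U n)) (h : ∀ x ∈ s, ∃ n, x ∈ U n) :
    ∃ N, ∀ x ∈ s, ∃ n ≤ N, x ∈ U n := by
  obtain ⟨t, ht⟩ := hs.elim_finite_subcover U hU fun x hx => Set.mem_iUnion.2 (h x hx)
  refine ⟨t.sup id, fun x hx => ?_⟩
  obtain ⟨n, hn, hxn⟩ := Set.mem_iUnion₂.1 (ht hx)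
  exact ⟨n, Finset.le_sup (f := id) hn, hxn⟩

/-- Follow `τ` for `m` steps, and then `σ` from its start. -/
def concatLaw {K : ℕ} (τ : ℕ → Fin K) (m : ℕ) (σ : ℕ → Fin K) (i : ℕ) : Fin K :=
  if i < m then τ i else σ (i - m)

theorem trajectory_concatLaw {d K : ℕ} (S : Fin K → Matrix (Fin d) (Fin d) ℝ)
    (τ σ : ℕ → Fin K) (x : State d) (m n : ℕ) :
    trajectory S (concatLaw τ m σ) x (m + n) = trajectory S σ (trajectory S τ x m) n := by
  have h1 : switchProd S (concatLaw τ m σ) m = switchProd S τ m :=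
    switchProd_congr S _ _ m fun i hi => by simp [concatLaw, hi]
  have h2 : (fun i => concatLaw τ m σ (m + i)) = σ := by
    funext i
    simp [concatLaw]
  simp only [trajectory_eq, switchProd_add, h1, h2]
  simp [toMap]

/-- If from every state a step `R 1` can be made in time between `1` and `N`, then steps can be
composed. -/
theorem exists_law_iterate {d K N : ℕ} (S : Fin K → Matrix (Fin d) (Fin d) ℝ) (σ : ℕ → Fin K)
    (R : ℕ → State d → State d → Prop) (h0 : ∀ x, R 0 x x)
    (hR : ∀ k x y z, R k x y → R 1 y z → R (k + 1) x z)
    (h : ∀ x, ∃ n, 1 ≤ n ∧ n ≤ N ∧ R 1 x (trajectory S σ x n)) (x : State d) (k : ℕ) :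
    ∃ (τ : ℕ → Fin K) (m : ℕ), k ≤ m ∧ m ≤ k * N ∧ R k x (trajectory S τ x m) := by
  induction k with
  | zero => exact ⟨σ, 0, le_rfl, by simp, h0 x⟩
  | succ k ih =>
    obtain ⟨τ, m, hkm, hmN, hm⟩ := ih
    obtain ⟨n, hn1, hnN, hn⟩ := h (trajectory S τ x m)
    -- The restart depends on the state reached, so the law built depends on `x`. Since `1 ≤ n`,
    -- each round takes time, which keeps `k + 1 ≤ m + n`.
    refine ⟨concatLaw τ m σ, m + n, by omega, ?_, ?_⟩
    · rw [add_mul, one_mul]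
      omega
    · rw [trajectory_concatLaw]
      exact hR _ _ _ _ hm hn

/-- The sets of vectors of norm above `2` at time `n` are open, and by the limsup condition they
cover the sphere; linearity extends the bound from the sphere to all vectors. -/
theorem IsFiberChaotic.exists_bound_growth {d K : ℕ} {S : Fin K → Matrix (Fin d) (Fin d) ℝ}
    {σ : ℕ → Fin K} (hσ : IsFiberChaotic S σ) :
    ∃ N, 1 ≤ N ∧ ∀ x, ∃ n, 1 ≤ n ∧ n ≤ N ∧ 2 * ‖x‖ ≤ ‖trajectory S σ x n‖ := by
  obtain ⟨N, hN⟩ := exists_bound_of_isCompact (isCompact_sphere (0 : State d) 1)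
    (U := fun n => {x | 2 < ‖trajectory S σ x n‖})
    (fun n => isOpen_lt continuous_const (continuous_trajectory S σ n).norm)
    fun x hx => exists_two_lt_norm_trajectory (hσ x (by rintro rfl; simp at hx)).2
  -- The cover may give `N = 0`, while the zero vector needs a time `n ≥ 1`.
  refine ⟨N + 1, by omega, fun x => ?_⟩
  rcases eq_or_ne x 0 with rfl | hx
  · exact ⟨1, le_rfl, by omega, by simp⟩
  have hx' : 0 < ‖x‖ := norm_pos_iff.2 hx
  obtain ⟨n, hnN, hn⟩ := hN (‖x‖⁻¹ • x) (by simp [norm_smul, hx'.ne'])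
  simp only [Set.mem_ofPred_eq, trajectory_smul, norm_smul, norm_inv, norm_norm] at hn
  rw [lt_inv_mul_iff₀ hx'] at hn
  refine ⟨n, Nat.one_le_iff_ne_zero.2 ?_, by omega, by linarith⟩
  -- At time `0` the strict inequality would read `2 * ‖x‖ < ‖x‖`.
  rintro rfl
  simp only [trajectory] at hn
  linarith

/-- The same compactness argument, now fed by the liminf condition. -/
theorem IsFiberChaotic.exists_bound_decay {d K : ℕ} {S : Fin K → Matrix (Fin d) (Fin d) ℝ}
    {σ : ℕ → Fin K} (hσ : IsFiberChaotic S σ) :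
    ∃ N, 1 ≤ N ∧ ∀ x, ∃ n, 1 ≤ n ∧ n ≤ N ∧ 2 * ‖trajectory S σ x n‖ ≤ ‖x‖ := by
  obtain ⟨N, hN⟩ := exists_bound_of_isCompact (isCompact_sphere (0 : State d) 1)
    (U := fun n => {x | 2 * ‖trajectory S σ x n‖ < 1})
    (fun n => isOpen_lt ((continuous_trajectory S σ n).norm.const_mul 2) continuous_const)
    fun x hx => exists_two_mul_norm_trajectory_lt (hσ x (by rintro rfl; simp at hx)).1
  refine ⟨N + 1, by omega, fun x => ?_⟩
  rcases eq_or_ne x 0 with rfl | hx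
  · exact ⟨1, le_rfl, by omega, by simp [trajectory]⟩
  have hx' : 0 < ‖x‖ := norm_pos_iff.2 hx
  obtain ⟨n, hnN, hn⟩ := hN (‖x‖⁻¹ • x) (by simp [norm_smul, hx'.ne'])
  simp only [Set.mem_ofPred_eq, trajectory_smul, norm_smul, norm_inv, norm_norm] at hn
  rw [mul_left_comm, inv_mul_lt_iff₀ hx', mul_one] at hn
  refine ⟨n, Nat.one_le_iff_ne_zero.2 ?_, by omega, hn.le⟩
  rintro rfl
  simp only [trajectory] at hn
  linarith

/-- Since `k / m ≥ 1 / N`, growth by `2 ^ k` within `k * N` steps yields a rate that does not depend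
on `k`. -/
theorem rpow_inv_le_root {N k m : ℕ} (hN : 1 ≤ N) (hm : 1 ≤ m) (hmN : m ≤ k * N) {a : ℝ}
    (ha : 2 ^ k ≤ a) : (2 : ℝ) ^ (1 / (N : ℝ)) ≤ a ^ (1 / (m : ℝ)) := by
  have hN' : (0 : ℝ) < N := by exact_mod_cast hN
  have hm' : (0 : ℝ) < m := by exact_mod_cast hm
  have hmN' : (m : ℝ) ≤ k * N := by exact_mod_cast hmN
  calc (2 : ℝ) ^ (1 / (N : ℝ)) ≤ 2 ^ ((k : ℝ) * (1 / (m : ℝ))) := by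
        refine Real.rpow_le_rpow_of_exponent_le one_le_two ?_
        rw [mul_one_div, div_le_div_iff₀ hN' hm']
        linarith
    _ = ((2 : ℝ) ^ k) ^ (1 / (m : ℝ)) := by
        rw [Real.rpow_mul zero_le_two, Real.rpow_natCast]
    _ ≤ a ^ (1 / (m : ℝ)) := Real.rpow_le_rpow (by positivity) ha (by positivity)

theorem IsFiberChaotic.one_lt_jointSpectralRadius {d K : ℕ} (hd : 1 ≤ d) (hK : 1 ≤ K)
    {S : Fin K → Matrix (Fin d) (Fin d) ℝ} {σ : ℕ → Fin K} (hσ : IsFiberChaotic S σ) :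
    1 < jointSpectralRadius S := by
  obtain ⟨N, hN, h⟩ := hσ.exists_bound_growth
  obtain ⟨x, hx⟩ := sphere_nonempty hd
  have hx1 : ‖x‖ = 1 := by simpa using hx
  have hc : (1 : ℝ) < 2 ^ (1 / (N : ℝ)) :=
    Real.one_lt_rpow one_lt_two (one_div_pos.2 (by exact_mod_cast hN))
  -- The lengths `m` cannot be prescribed, but the limit exists, so a bound for arbitrarily large
  -- `m` suffices.
  refine hc.trans_le (ge_of_tendsto_of_frequently (tendsto_jointSpectralRadius hK S) ?_)
  rw [frequently_atTop]
  intro k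
  obtain ⟨τ, m, hkm, hmN, hm⟩ := exists_law_iterate S σ (fun k x y => 2 ^ k * ‖x‖ ≤ ‖y‖)
    (fun x => by simp)
    (fun k x y z h1 h2 => by
      rw [pow_one] at h2
      rw [pow_succ]
      linarith)
    -- Using `k + 1` rounds forces `m ≥ 1`, so that the exponent `1 / m` is genuine.
    (fun x => by simpa using h x) x (k + 1)
  refine ⟨m, by omega, ?_⟩
  have hnorm := (toMap (switchProd S τ m)).le_opNorm x
  rw [hx1, mul_one] at hm hnorm
  rw [← trajectory_eq] at hnorm
  exact (rpow_inv_le_root hN (by omega) hmN (hm.trans hnorm)).trans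
    (le_ciSup (finite_range_comp S m fun A => matNorm A ^ (1 / (m : ℝ))).bddAbove τ)

/-- Nonsingularity makes the limit exist and the co-norms positive, so that they can be inverted. -/
theorem IsFiberChaotic.jointSpectralCoRadius_lt_one {d K : ℕ} (hd : 1 ≤ d) (hK : 1 ≤ K)
    {S : Fin K → Matrix (Fin d) (Fin d) ℝ} (hS : ∀ k, IsUnit (S k)) {σ : ℕ → Fin K}
    (hσ : IsFiberChaotic S σ) : jointSpectralCoRadius S < 1 := by
  obtain ⟨N, hN, h⟩ := hσ.exists_bound_decay
  obtain ⟨x, hx⟩ := sphere_nonempty hd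
  have hx1 : ‖x‖ = 1 := by simpa using hx
  have hc : (1 : ℝ) < 2 ^ (1 / (N : ℝ)) :=
    Real.one_lt_rpow one_lt_two (one_div_pos.2 (by exact_mod_cast hN))
  refine (le_of_tendsto_of_frequently (tendsto_jointSpectralCoRadius hK hd S hS) ?_).trans_lt
    (inv_lt_one_of_one_lt₀ hc)
  rw [frequently_atTop]
  intro k
  obtain ⟨τ, m, hkm, hmN, hm⟩ := exists_law_iterate S σ (fun k x y => 2 ^ k * ‖y‖ ≤ ‖x‖)
    (fun x => by simp)
    (fun k x y z h1 h2 => by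
      rw [pow_one] at h2
      rw [pow_succ, mul_assoc]
      exact (mul_le_mul_of_nonneg_left h2 (by positivity)).trans h1)
    (fun x => by simpa using h x) x (k + 1)
  refine ⟨m, by omega, ?_⟩
  have hpos := matCoNorm_pos hd _ (isUnit_switchProd S hS τ m)
  have hnorm := matCoNorm_mul_norm_le (switchProd S τ m) x
  rw [hx1, mul_one, ← trajectory_eq] at hnorm
  rw [hx1] at hm
  -- Decay of one unit vector bounds the co-norm from above; inverting turns this into the growth
  -- form that `rpow_inv_le_root` takes.
  have hinv : 2 ^ (k + 1) ≤ (matCoNorm (switchProd S τ m))⁻¹ := by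
    rw [le_inv_comm₀ (by positivity) hpos, ← one_div, le_div_iff₀ (by positivity), mul_comm]
    exact (mul_le_mul_of_nonneg_left hnorm (by positivity)).trans hm
  have hroot := rpow_inv_le_root hN (by omega) hmN hinv
  rw [Real.inv_rpow hpos.le, le_inv_comm₀ (by positivity) (by positivity)] at hroot
  exact (ciInf_le (finite_range_comp S m fun A => matCoNorm A ^ (1 / (m : ℝ))).bddBelow τ).trans
    hroot

end LinearInclusion

theorem theorem5p1 {d K : ℕ} (hd : 1 ≤ d) (hK : 2 ≤ K)
    (S : Fin K → Matrix (Fin d) (Fin d) ℝ) :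
    (LinearInclusion.jointSpectralRadius S = 1 →
      ¬ ∃ σ : ℕ → Fin K, LinearInclusion.IsFiberChaotic S σ) ∧
    ((∀ k, IsUnit (S k)) → LinearInclusion.jointSpectralCoRadius S = 1 →
      ¬ ∃ σ : ℕ → Fin K, LinearInclusion.IsFiberChaotic S σ) := by
  have hK1 : 1 ≤ K := one_le_two.trans hK
  refine ⟨?_, ?_⟩
  · rintro h ⟨σ, hσ⟩
    exact (hσ.one_lt_jointSpectralRadius hd hK1).ne' h
  · rintro hS h ⟨σ, hσ⟩
    exact (hσ.jointSpectralCoRadius_lt_one hd hK1 hS).ne h
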